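/- Fix a field $K$ and real numbers $t_1,t_2$. A persistence module $M$ is a family of $K$-vector spaces $(M_a)_{a\in\mathbb R}$ with linear transition maps $M_a\to M_b$ for $a\le b$, which are the identity for $a=b$ and compatible with composition. For $b\in\mathbb R$ and $d\in\mathbb R\cup\{\infty\}$ with $b<d$, the interval module $I[b,d)$ is $K$ at heights in $[b,d)$ and $0$ elsewhere, with identity maps inside the interval. If $M\cong\bigoplus_{i=1}^N I[b_i,d_i)$, the $[b_i,d_i)$ are called the intervals in the interval decomposition of $M$, and the finite multiset of points $(b_i,d_i)$ is the persistence diagram of $M$. Persistence diagrams are compared by the bottleneck distance (with $|\infty-\infty|=0$ and $|\infty-x|=\infty$ for real $x$). A (1-Lipschitz) vineyard module over $[t_1,t_2]$ is a family of persistence modules $(V_t)_{t\in[t_1,t_2]}$ together with, for all $s<t$, a $(t-s)$-interleaving $\alpha_s^t:V_s\to V_t$, $\beta_t^s:V_t\to V_s$, such that the interleaving maps commute with each other and with the transition maps; in particular $\alpha_s^t\circ\alpha_r^s=\alpha_r^t$ and $\beta_s^r\circ\beta_t^s=\beta_t^r$ for $r<s<t$. Direct sums are formed at each time and for all maps; an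 isomorphism of vineyard modules is a family of isomorphisms of the persistence modules at each time that commutes with the interleaving maps. A vine over $[t_1,t_2]$ is a map $\gamma$ from $[t_1,t_2]$ to persistence diagrams that is continuous for the bottleneck distance, such that each $\gamma(t)$ has at most one off-diagonal point and the support $\operatorname{supp}\gamma=\{t:\gamma(t)\text{ has an off-diagonal point}\}$ is a non-empty interval. For $t\in\operatorname{supp}\gamma$ write $\gamma(t)=(\mathrm b(\gamma(t)),\mathrm d(\gamma(t)))$. A vine of a vineyard module $X$ is a member of a finite family of vines over $[t_1,t_2]$ whose union at each time $t$, counted with multiplicity, is the persistence diagram of $X_t$. **Proposition.** Let $X$, $V$, $W$ be vineyard modules over $[t_1,t_2]$ such that for every $t$ each of $X_t,V_t,W_t$ is isomorphic to a finite direct sum of interval modules $I[b_i,d_i)$ of pairwise distinct intervals. Suppose that $X\cong V\oplus W$ as vineyard modules, and let $\gamma$ be a vine of $X$. Then either $[\mathrm b(\gamma(t)),\mathrm d(\gamma(t)))$ is an interval in the interval decomposition of $V_t$ for all $t\in\operatorname{supp}\gamma$, or $[\mathrm b(\gamma(t)),\mathrm d(\gamma(t)))$ is an interval in the interval decomposition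 of $W_t$ for all $t\in\operatorname{supp}\gamma$. -/

import Mathlib

open scoped ENNReal

universe u v w

/-! Persistence modules over `ℝ`. The real parameter is called the height. -/

/-- A persistence module over the field `K`: vector spaces indexed by `ℝ` with transition maps. -/
structure PersistenceModule (K : Type u) [Field K] where
  /-- the vector space at each height -/
  obj : ℝ → Type v
  [addCommGroup : ∀ a, AddCommGroup (obj a)]
  [module : ∀ a, Module K (obj a)]
  /-- the transition maps -/
  map : ∀ {a b : ℝ}, a ≤ b → obj a →ₗ[K] obj b
  map_id : ∀ (a : ℝ) (x : obj a), map (le_refl a) x = x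
  map_comp : ∀ {a b c : ℝ} (hab : a ≤ b) (hbc : b ≤ c) (x : obj a),
    map hbc (map hab x) = map (hab.trans hbc) x

attribute [instance] PersistenceModule.addCommGroup PersistenceModule.module

namespace PersistenceModule

variable {K : Type u} [Field K]

/-- An isomorphism of persistence modules: linear isomorphisms at each height that commute with
the transition maps. -/
structure Iso (X : PersistenceModule.{u, v} K) (Y : PersistenceModule.{u, w} K) where
  equiv : ∀ a : ℝ, X.obj a ≃ₗ[K] Y.obj a
  comm : ∀ {a b : ℝ} (h : a ≤ b) (x : X.obj a), equiv b (X.map h x) = Y.map h (equiv a x)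

/-- An `ε`-morphism `X → Y`: linear maps `X_a → Y_{a + ε}` that commute with the transition
maps. -/
structure ShiftHom (X : PersistenceModule.{u, v} K) (Y : PersistenceModule.{u, w} K) (ε : ℝ) where
  app : ∀ a : ℝ, X.obj a →ₗ[K] Y.obj (a + ε)
  comm : ∀ {a b : ℝ} (h : a ≤ b) (x : X.obj a),
    app b (X.map h x) = Y.map (by linarith) (app a x)

/-- The pair `α : X → Y`, `β : Y → X` of `ε`-morphisms is an `ε`-interleaving: both composites
are the transition maps that raise the height by `2 ε`. -/
structure IsInterleaving {X : PersistenceModule.{u, v} K} {Y : PersistenceModule.{u, w} K} {ε : ℝ}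
    (hε : 0 ≤ ε) (α : ShiftHom X Y ε) (β : ShiftHom Y X ε) : Prop where
  left : ∀ (a : ℝ) (x : X.obj a), β.app (a + ε) (α.app a x) = X.map (by linarith) x
  right : ∀ (a : ℝ) (y : Y.obj a), α.app (a + ε) (β.app a y) = Y.map (by linarith) y

/-- The direct sum of two persistence modules. -/
def directSum (X : PersistenceModule.{u, v} K) (Y : PersistenceModule.{u, w} K) :
    PersistenceModule.{u, max v w} K where
  obj a := X.obj a × Y.obj a
  map h := (X.map h).prodMap (Y.map h)
  map_id a x := by simp [X.map_id, Y.map_id]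
  map_comp hab hbc x := by simp [X.map_comp, Y.map_comp]

/-- The direct sum of a finite family of persistence modules (for a finite index type the direct
sum of vector spaces is their product). -/
def finiteSum {n : ℕ} (X : Fin n → PersistenceModule.{u, v} K) : PersistenceModule.{u, v} K where
  obj a := ∀ i, (X i).obj a
  map h := LinearMap.pi fun i => (X i).map h ∘ₗ LinearMap.proj i
  map_id a x := by ext i; simp [(X i).map_id]
  map_comp hab hbc x := by ext i; simp [(X i).map_comp]

/-- The direct sum of two `ε`-morphisms. -/
def ShiftHom.directSum {X Y X' Y' : PersistenceModule.{u, v} K} {ε : ℝ}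
    (f : ShiftHom X Y ε) (g : ShiftHom X' Y' ε) :
    ShiftHom (X.directSum X') (Y.directSum Y') ε where
  app a := (f.app a).prodMap (g.app a)
  comm h x := Prod.ext (f.comm h x.1) (g.comm h x.2)

end PersistenceModule

/-- A non-empty interval `[birth, death)` with `birth` real and `death` real or `∞`; equivalently,
an off-diagonal point of a persistence diagram. -/
@[ext] structure Bar where
  birth : ℝ
  death : WithTop ℝ
  lt : (birth : WithTop ℝ) < death

/-- The height `a` lies in the interval `[birth, death)`. -/
def Bar.Contains (p : Bar) (a : ℝ) : Prop := p.birth ≤ a ∧ (a : WithTop ℝ) < p.death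

open Classical in
/-- The interval module of `[b, d)`. Its space at height `a` consists of the functions to `K` on
the proofs of `a ∈ [b, d)`: it is a copy of `K` for `a ∈ [b, d)` and zero otherwise. The transition
map is the identity of `K` if both heights lie in `[b, d)`, and zero otherwise. -/
noncomputable def intervalModule (K : Type u) [Field K] (p : Bar) : PersistenceModule.{u, u} K where
  obj a := PLift (p.Contains a) → K
  map {a b} _ :=
    { toFun := fun f _ => if ha : p.Contains a then f ⟨ha⟩ else 0
      map_add' := by intro f g; ext i; by_cases ha : p.Contains a <;> simp [ha]
      map_smul' := by intro c f; ext i; by_cases ha : p.Contains a <;> simp [ha] }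
  map_id a x := by ext i; simp [i.down]
  map_comp {a b c} hab hbc x := by
    ext i
    by_cases ha : p.Contains a
    · have hb : p.Contains b :=
        ⟨ha.1.trans hab, (WithTop.coe_le_coe.2 hbc).trans_lt i.down.2⟩
      simp [ha, hb]
    · simp [ha]

/-- A persistence diagram: its finitely many off-diagonal points, with multiplicity. -/
abbrev Diagram := Multiset Bar

/-- `D` is the persistence diagram of `M`: `M` is isomorphic to the direct sum of the interval
modules of the points of `D`. -/
def PersistenceModule.HasDiagram {K : Type u} [Field K] (M : PersistenceModule.{u, v} K)
    (D : Diagram) : Prop :=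
  ∃ (n : ℕ) (p : Fin n → Bar), Finset.univ.val.map p = D ∧
    Nonempty (M.Iso (PersistenceModule.finiteSum fun i => intervalModule K (p i)))

/-- `M` is a finite direct sum of interval modules of pairwise distinct intervals. -/
def PersistenceModule.IsMultiplicityFree {K : Type u} [Field K] (M : PersistenceModule.{u, v} K) : Prop :=
  ∃ D : Diagram, D.Nodup ∧ M.HasDiagram D

/-- `p` is one of the intervals of an interval decomposition of `M`. -/
def PersistenceModule.HasBar {K : Type u} [Field K] (M : PersistenceModule.{u, v} K)
    (p : Bar) : Prop :=
  ∃ D : Diagram, M.HasDiagram D ∧ p ∈ D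

/-! The bottleneck distance. -/

/-- The distance on `ℝ ∪ {∞}`, with `|∞ - ∞| = 0` and `|∞ - x| = ∞` for real `x`. -/
noncomputable def extDist : WithTop ℝ → WithTop ℝ → ℝ≥0∞
  | some x, some y => edist x y
  | none, none => 0
  | _, _ => ⊤

/-- The sup-distance of two off-diagonal points. -/
noncomputable def Bar.dist (p q : Bar) : ℝ≥0∞ :=
  max (edist p.birth q.birth) (extDist p.death q.death)

/-- Half of the length of an interval: the distance of the point from the diagonal. -/
noncomputable def Bar.diagDist (p : Bar) : ℝ≥0∞ := extDist p.birth p.death / 2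

/-- A transportation plan between two diagrams: some points of `D` are paired with some points
of `E`, each point (counted with multiplicity) in at most one pair. -/
structure TransportPlan (D E : Diagram) where
  pairs : Multiset (Bar × Bar)
  unmatchedLeft : Multiset Bar
  unmatchedRight : Multiset Bar
  left_eq : pairs.map Prod.fst + unmatchedLeft = D
  right_eq : pairs.map Prod.snd + unmatchedRight = E

/-- The cost of a transportation plan. -/
noncomputable def TransportPlan.cost {D E : Diagram} (P : TransportPlan D E) : ℝ≥0∞ :=
  max (P.pairs.map fun x => x.1.dist x.2).sup
    (max (P.unmatchedLeft.map Bar.diagDist).sup (P.unmatchedRight.map Bar.diagDist).sup)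

/-- The bottleneck distance of two persistence diagrams. -/
noncomputable def bottleneckDist (D E : Diagram) : ℝ≥0∞ := ⨅ P : TransportPlan D E, P.cost

/-- Continuity of a map from `[t₁, t₂]` to diagrams with respect to the bottleneck distance. -/
def BottleneckContinuous {t₁ t₂ : ℝ} (γ : Set.Icc t₁ t₂ → Diagram) : Prop :=
  ∀ t : Set.Icc t₁ t₂, ∀ ε : ℝ≥0∞, 0 < ε → ∃ δ : ℝ, 0 < δ ∧
    ∀ s : Set.Icc t₁ t₂, |(s : ℝ) - t| < δ → bottleneckDist (γ s) (γ t) < ε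

/-- The times at which the diagram has an off-diagonal point. -/
def diagramSupport {t₁ t₂ : ℝ} (γ : Set.Icc t₁ t₂ → Diagram) : Set (Set.Icc t₁ t₂) :=
  {t | ∃ p, p ∈ γ t}

/-- A vine over `[t₁, t₂]`: a bottleneck-continuous map to diagrams with at most one off-diagonal
point, whose support is a non-empty interval. -/
structure IsVine {t₁ t₂ : ℝ} (γ : Set.Icc t₁ t₂ → Diagram) : Prop where
  continuous : BottleneckContinuous γ
  support_nonempty : (diagramSupport γ).Nonempty
  support_interval : (diagramSupport γ).OrdConnected
  card_le_one : ∀ t, (γ t).card ≤ 1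

/-! Vineyard modules. -/

/-- A (`1`-Lipschitz) vineyard module over the time interval `[t₁, t₂]`: a persistence module at
each time and, for `s < t`, a `(t - s)`-interleaving `α s t : V_s → V_t`, `β s t : V_t → V_s`, such
that the interleaving maps are compatible under composition. The two sides of `α_comp` and of
`β_comp` live at the same height, written in two ways; the transition map there only identifies
the two spaces. -/
structure VineyardModule (K : Type u) [Field K] (t₁ t₂ : ℝ) where
  obj : Set.Icc t₁ t₂ → PersistenceModule.{u, v} K
  α : ∀ s t : Set.Icc t₁ t₂, s < t → (obj s).ShiftHom (obj t) ((t : ℝ) - s)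
  β : ∀ s t : Set.Icc t₁ t₂, s < t → (obj t).ShiftHom (obj s) ((t : ℝ) - s)
  interleaving : ∀ (s t : Set.Icc t₁ t₂) (h : s < t),
    PersistenceModule.IsInterleaving (sub_nonneg.2 (Subtype.coe_le_coe.2 h.le)) (α s t h) (β s t h)
  α_comp : ∀ (r s t : Set.Icc t₁ t₂) (hrs : r < s) (hst : s < t) (a : ℝ) (x : (obj r).obj a),
    (α s t hst).app _ ((α r s hrs).app a x) =
      (obj t).map (by linarith) ((α r t (hrs.trans hst)).app a x)
  β_comp : ∀ (r s t : Set.Icc t₁ t₂) (hrs : r < s) (hst : s < t) (a : ℝ) (x : (obj t).obj a),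
    (β r s hrs).app _ ((β s t hst).app a x) =
      (obj r).map (by linarith) ((β r t (hrs.trans hst)).app a x)

namespace VineyardModule

variable {K : Type u} [Field K] {t₁ t₂ : ℝ}

/-- The direct sum of two vineyard modules. -/
def directSum (V W : VineyardModule.{u, v} K t₁ t₂) : VineyardModule.{u, v} K t₁ t₂ where
  obj t := (V.obj t).directSum (W.obj t)
  α s t h := (V.α s t h).directSum (W.α s t h)
  β s t h := (V.β s t h).directSum (W.β s t h)
  interleaving s t h :=
    { left := fun a x => Prod.ext ((V.interleaving s t h).left a x.1)
        ((W.interleaving s t h).left a x.2)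
      right := fun a x => Prod.ext ((V.interleaving s t h).right a x.1)
        ((W.interleaving s t h).right a x.2) }
  α_comp r s t hrs hst a x := Prod.ext (V.α_comp r s t hrs hst a x.1) (W.α_comp r s t hrs hst a x.2)
  β_comp r s t hrs hst a x := Prod.ext (V.β_comp r s t hrs hst a x.1) (W.β_comp r s t hrs hst a x.2)

/-- An isomorphism of vineyard modules: isomorphisms of persistence modules at each time that
commute with the interleaving maps. -/
structure Iso (X Y : VineyardModule.{u, v} K t₁ t₂) where
  iso : ∀ t, (X.obj t).Iso (Y.obj t)
  comm_α : ∀ (s t : Set.Icc t₁ t₂) (h : s < t) (a : ℝ) (x : (X.obj s).obj a),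
    (iso t).equiv _ ((X.α s t h).app a x) = (Y.α s t h).app a ((iso s).equiv a x)
  comm_β : ∀ (s t : Set.Icc t₁ t₂) (h : s < t) (a : ℝ) (x : (X.obj t).obj a),
    (iso s).equiv _ ((X.β s t h).app a x) = (Y.β s t h).app a ((iso t).equiv a x)

/-- At every time the persistence module is a finite direct sum of interval modules of pairwise
distinct intervals. -/
def IsGeneric (X : VineyardModule.{u, v} K t₁ t₂) : Prop := ∀ t, (X.obj t).IsMultiplicityFree

/-- `γ` is a vine of `X`: it is one of finitely many vines over `[t₁, t₂]` whose union is the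
underlying vineyard of `X`. -/
def IsVineOf (X : VineyardModule.{u, v} K t₁ t₂) (γ : Set.Icc t₁ t₂ → Diagram) : Prop :=
  ∃ (n : ℕ) (g : Fin n → Set.Icc t₁ t₂ → Diagram),
    (∀ i, IsVine (g i)) ∧ (∀ t, (X.obj t).HasDiagram (∑ i, g i t)) ∧ ∃ i, g i = γ

end VineyardModule

/-! The set of times at which the point of the vine `γ` is an interval of `V` is shown to be open
and closed in the support of `γ`, which is an interval and hence connected.

Intervals of a persistence module `M` are detected without reference to a decomposition
(`HasSummand`): `[b, d)` is an interval of `M` exactly if there are an element `x ∈ M_b` that dies at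
height `d` and a family of functionals on `M`, compatible with the transition maps on `[b, d)` and
vanishing on what is born before `b`, that is non-zero on `x`. This is a morphism from the interval
module to `M` and one back whose composite is non-zero. If `M` is a sum of interval modules, such a
pairing is a sum over the summands, and a summand can contribute only if its end points match
(`IsCosection.bounds_of_apply_single_ne_zero`). Three consequences carry the argument.

* An interval of `V ⊕ W` is an interval of `V` or of `W`, since the pairing is additive
  (`hasSummand_or_of_directSum`); it cannot be one of both if the sum is multiplicity free, since two
  independent pairings cannot both factor through a single copy of `K`
  (`HasDiagram.false_of_orthogonal_pairings`).
* If `M` and `N` are `δ`-interleaved, an interval of `M` of length more than `2δ` has an interval of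
  `N` within distance `δ` (`HasSummand.exists_near_of_interleaving`): shift the pairing along the
  interleaving. This weak form of the stability theorem needs no matching of the intervals.
* Hence, if the point of the vine is not an interval of `W_t`, the same holds at nearby times
  (`exists_forall_not_hasSummand`): an interval of `W_s` close to it would give an interval of `W_t`
  close to it, but the finitely many intervals of `W_t` stay away from it. -/

namespace PersistenceModule

variable {K : Type u} [Field K]

/-! ### Isomorphisms and finite sums -/

/-- The inverse of an isomorphism of persistence modules. -/
def Iso.symm {X : PersistenceModule.{u, v} K} {Y : PersistenceModule.{u, w} K} (e : X.Iso Y) :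
    Y.Iso X where
  equiv a := (e.equiv a).symm
  comm h y := by rw [LinearEquiv.symm_apply_eq, e.comm, LinearEquiv.apply_symm_apply]

/-- The inclusion of a summand into a finite direct sum, at a fixed height. -/
def finiteSumSingle {n : ℕ} (X : Fin n → PersistenceModule.{u, v} K) (a : ℝ) (j : Fin n) :
    (X j).obj a →ₗ[K] (finiteSum X).obj a :=
  LinearMap.single K (fun i => (X i).obj a) j

theorem map_finiteSumSingle {n : ℕ} (X : Fin n → PersistenceModule.{u, v} K) {a b : ℝ}
    (h : a ≤ b) (j : Fin n) (x : (X j).obj a) :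
    (finiteSum X).map h (finiteSumSingle X a j x) = finiteSumSingle X b j ((X j).map h x) := by
  funext k
  change (X k).map h (Pi.single (M := fun i => (X i).obj a) j x k) =
    Pi.single (M := fun i => (X i).obj b) j ((X j).map h x) k
  rcases eq_or_ne k j with rfl | hk
  · simp
  · simp [hk]

theorem sum_finiteSumSingle {n : ℕ} (X : Fin n → PersistenceModule.{u, v} K) (a : ℝ)
    (y : (finiteSum X).obj a) : ∑ j, finiteSumSingle X a j (y j) = y :=
  Finset.univ_sum_single (M := fun i => (X i).obj a) y

theorem intervalModule_map_apply {p : Bar} {a b : ℝ} (h : a ≤ b) (f : (intervalModule K p).obj a)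
    (ha : p.Contains a) (hb : PLift (p.Contains b)) :
    (intervalModule K p).map h f hb = f ⟨ha⟩ :=
  dif_pos ha

theorem intervalModule_map_apply_of_not {p : Bar} {a b : ℝ} (h : a ≤ b)
    (f : (intervalModule K p).obj a) (ha : ¬ p.Contains a) (hb : PLift (p.Contains b)) :
    (intervalModule K p).map h f hb = 0 :=
  dif_neg ha

/-- The element of an interval module at height `a` with value `r`; it is zero outside of the
interval. -/
def intervalConst (p : Bar) (a : ℝ) (r : K) : (intervalModule K p).obj a :=
  fun _ : PLift (p.Contains a) => r

theorem intervalModule_eq_zero_of_death_le {p : Bar} {a : ℝ} (h : p.death ≤ (a : WithTop ℝ))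
    (f : (intervalModule K p).obj a) : f = 0 :=
  funext fun k : PLift (p.Contains a) => absurd (k.down.2.trans_le h) (lt_irrefl _)

/-! ### Detecting intervals by pairings -/

/-- The functionals `ψ a`, at the heights `a ∈ [l, u)`, form a morphism from `N` to the interval
module of `[l, u)`. Their values at other heights are irrelevant. -/
structure IsCosection (N : PersistenceModule.{u, v} K) (l : ℝ) (d : WithTop ℝ)
    (ψ : ∀ a, N.obj a →ₗ[K] K) : Prop where
  map_eq : ∀ {a b : ℝ} (h : a ≤ b) (y : N.obj a), l ≤ a → (b : WithTop ℝ) < d →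
    ψ b (N.map h y) = ψ a y
  map_eq_zero : ∀ {a b : ℝ} (h : a ≤ b) (y : N.obj a), a < l → l ≤ b → (b : WithTop ℝ) < d →
    ψ b (N.map h y) = 0

/-- The element `y` of height `c` is zero from the height `e` on. -/
def DiesAt (N : PersistenceModule.{u, v} K) {c : ℝ} (y : N.obj c) (e : WithTop ℝ) : Prop :=
  ∀ {a : ℝ} (h : c ≤ a), e ≤ (a : WithTop ℝ) → N.map h y = 0

/-- The interval module of `p` is a direct summand of `M`: there are morphisms from it to `M` and
back whose composite is non-zero. The first is given by the image `x` of the generator, the second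
by a family of functionals. -/
def HasSummand (M : PersistenceModule.{u, v} K) (p : Bar) : Prop :=
  ∃ (x : M.obj p.birth) (φ : ∀ a, M.obj a →ₗ[K] K),
    M.DiesAt x p.death ∧ M.IsCosection p.birth p.death φ ∧ φ p.birth x ≠ 0

theorem IsCosection.comp_iso {M : PersistenceModule.{u, v} K} {N : PersistenceModule.{u, w} K}
    {l : ℝ} {d : WithTop ℝ} {ψ : ∀ a, M.obj a →ₗ[K] K} (hψ : M.IsCosection l d ψ) (e : N.Iso M) :
    N.IsCosection l d fun a => ψ a ∘ₗ (e.equiv a).toLinearMap where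
  map_eq h y hl hd := by
    simpa [e.comm] using hψ.map_eq h (e.equiv _ y) hl hd
  map_eq_zero h y ha hl hd := by
    simpa [e.comm] using hψ.map_eq_zero h (e.equiv _ y) ha hl hd

theorem DiesAt.map_iso {M : PersistenceModule.{u, v} K} {N : PersistenceModule.{u, w} K}
    {c : ℝ} {y : M.obj c} {d : WithTop ℝ} (hy : M.DiesAt y d) (e : M.Iso N) :
    N.DiesAt (e.equiv c y) d := fun h hd => by rw [← e.comm, hy h hd, map_zero]

theorem HasSummand.of_iso {M : PersistenceModule.{u, v} K} {N : PersistenceModule.{u, w} K}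
    {p : Bar} (h : M.HasSummand p) (e : M.Iso N) : N.HasSummand p := by
  obtain ⟨x, φ, hx, hφ, hne⟩ := h
  exact ⟨e.equiv _ x, _, hx.map_iso e, hφ.comp_iso e.symm, by simpa [Iso.symm] using hne⟩

/-- A summand of a sum of interval modules contributes to a pairing only if its interval contains
`c`, its birth is at least `l`, and its death lies between that of the functionals and that of the
element. -/
theorem IsCosection.bounds_of_apply_single_ne_zero {n : ℕ} {p : Fin n → Bar} {l c : ℝ}
    {d e : WithTop ℝ} {ψ : ∀ a, (finiteSum fun i => intervalModule K (p i)).obj a →ₗ[K] K}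
    (hψ : IsCosection _ l d ψ) (hl : l ≤ c) (hd : (c : WithTop ℝ) < d)
    {y : (finiteSum fun i => intervalModule K (p i)).obj c} (hy : DiesAt _ y e) {j : Fin n}
    (hne : ψ c (finiteSumSingle _ c j (y j)) ≠ 0) :
    (l ≤ (p j).birth ∧ (p j).birth ≤ c) ∧ d ≤ (p j).death ∧ (p j).death ≤ e := by
  have hyj : y j ≠ 0 := fun h => hne (by rw [h, map_zero, map_zero])
  obtain ⟨i, hi⟩ : ∃ i, y j i ≠ 0 := by
    by_contra! h
    exact hyj (funext h)
  have hc := i.down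
  refine ⟨⟨?_, hc.1⟩, ?_, ?_⟩
  · -- Otherwise the summand is born before `l`, and the functionals vanish on it.
    by_contra! hlt
    have hb : (p j).Contains (p j).birth := ⟨le_rfl, (p j).lt⟩
    have hbc : (p j).birth ≤ c := hc.1
    have key : y j = (intervalModule K (p j)).map hbc (intervalConst (p j) _ (y j i)) :=
      funext fun k => (congrArg (y j) (Subsingleton.elim k i)).trans
        (intervalModule_map_apply hbc (intervalConst (p j) _ (y j i)) hb k).symm
    apply hne
    rw [key, ← map_finiteSumSingle]
    exact hψ.map_eq_zero _ _ hlt hl hd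
  · -- Otherwise the summand dies while the functionals are still constant.
    by_contra! hlt
    obtain ⟨r, hr⟩ := WithTop.ne_top_iff_exists.1 hlt.ne_top
    have hcr : c ≤ r := (WithTop.coe_lt_coe.1 (hr ▸ hc.2)).le
    apply hne
    rw [← hψ.map_eq hcr _ hl (hr ▸ hlt), map_finiteSumSingle,
      intervalModule_eq_zero_of_death_le hr.ge ((intervalModule K (p j)).map hcr (y j)),
      map_zero, map_zero]
  · -- Otherwise the component of `y` survives the death of `y`.
    by_contra! hlt
    obtain ⟨r, hr⟩ := WithTop.ne_top_iff_exists.1 hlt.ne_top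
    have hm : (p j).Contains (max c r) := by
      refine ⟨hc.1.trans (le_max_left _ _), ?_⟩
      rcases max_choice c r with h | h <;> rw [h]
      · exact hc.2
      · exact hr ▸ hlt
    have h0 := hy (le_max_left c r) (hr ▸ WithTop.coe_le_coe.2 (le_max_right c r))
    have h1 : (intervalModule K (p j)).map (le_max_left c r) (y j) = 0 := congrFun h0 j
    apply hi
    rw [← intervalModule_map_apply (le_max_left c r) (y j) hc ⟨hm⟩, h1]
    rfl

theorem HasDiagram.exists_mem_of_pairing {M : PersistenceModule.{u, v} K} {D : Diagram}
    (hD : M.HasDiagram D) {l c : ℝ} {d e : WithTop ℝ} {ψ : ∀ a, M.obj a →ₗ[K] K}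
    (hψ : M.IsCosection l d ψ) (hl : l ≤ c) (hd : (c : WithTop ℝ) < d) {y : M.obj c}
    (hy : M.DiesAt y e) (hne : ψ c y ≠ 0) :
    ∃ q ∈ D, (l ≤ q.birth ∧ q.birth ≤ c) ∧ d ≤ q.death ∧ q.death ≤ e := by
  obtain ⟨n, p, rfl, ⟨f⟩⟩ := hD
  have hψ' := hψ.comp_iso f.symm
  have hne' : (ψ c ∘ₗ (f.symm.equiv c).toLinearMap) (f.equiv c y) ≠ 0 := by
    simpa [Iso.symm] using hne
  rw [← sum_finiteSumSingle _ c (f.equiv c y), map_sum] at hne'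
  obtain ⟨j, -, hj⟩ := Finset.exists_ne_zero_of_sum_ne_zero hne'
  exact ⟨p j, Multiset.mem_map_of_mem p (Finset.mem_univ j),
    hψ'.bounds_of_apply_single_ne_zero hl hd (hy.map_iso f) hj⟩

open Classical in
theorem hasSummand_finiteSum {n : ℕ} (p : Fin n → Bar) (j : Fin n) :
    (finiteSum fun i => intervalModule K (p i)).HasSummand (p j) := by
  have hb : (p j).Contains (p j).birth := ⟨le_rfl, (p j).lt⟩
  let φ : ∀ a, (finiteSum fun i => intervalModule K (p i)).obj a →ₗ[K] K := fun a =>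
    { toFun := fun y => if h : (p j).Contains a then y j ⟨h⟩ else 0
      map_add' := fun y z => by
        by_cases h : (p j).Contains a
        · simp only [h, dif_pos]; rfl
        · simp [h]
      map_smul' := fun r y => by
        by_cases h : (p j).Contains a
        · simp only [h, dif_pos]; rfl
        · simp [h] }
  have hφ : ∀ {a} (h : (p j).Contains a) y, φ a y = y j ⟨h⟩ := fun h y => dif_pos h
  refine ⟨finiteSumSingle _ _ j (intervalConst (p j) _ 1), φ, ?_, ⟨?_, ?_⟩, ?_⟩
  · intro a h hd
    rw [map_finiteSumSingle, intervalModule_eq_zero_of_death_le hd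
      ((intervalModule K (p j)).map h (intervalConst (p j) _ 1)), map_zero]
  · intro a b h y hl hd
    have hcb : (p j).Contains b := ⟨hl.trans h, hd⟩
    have hca : (p j).Contains a := ⟨hl, (WithTop.coe_le_coe.2 h).trans_lt hd⟩
    rw [hφ hcb, hφ hca]
    exact intervalModule_map_apply h (y j) hca ⟨hcb⟩
  · intro a b h y ha hl hd
    have hcb : (p j).Contains b := ⟨hl, hd⟩
    rw [hφ hcb]
    exact intervalModule_map_apply_of_not h (y j) (fun hca => hca.1.not_gt ha) ⟨hcb⟩
  · rw [hφ hb]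
    have : finiteSumSingle (fun i => intervalModule K (p i)) (p j).birth j
        (intervalConst (p j) _ 1) j = intervalConst (p j) _ 1 :=
      Pi.single_eq_same (M := fun i => (intervalModule K (p i)).obj (p j).birth) j _
    rw [this]
    exact one_ne_zero

/-- Detection by pairings agrees with membership in any interval decomposition. In particular all
decompositions have the same intervals. -/
theorem HasDiagram.mem_iff {M : PersistenceModule.{u, v} K} {D : Diagram} (hD : M.HasDiagram D)
    {p : Bar} : p ∈ D ↔ M.HasSummand p := by
  constructor
  · obtain ⟨n, q, rfl, ⟨f⟩⟩ := hD
    intro hp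
    obtain ⟨j, -, rfl⟩ := Multiset.mem_map.1 hp
    exact (hasSummand_finiteSum q j).of_iso f.symm
  · rintro ⟨x, φ, hx, hφ, hne⟩
    obtain ⟨q, hq, ⟨h1, h2⟩, h3, h4⟩ := hD.exists_mem_of_pairing hφ le_rfl p.lt hx hne
    rwa [Bar.ext (le_antisymm h1 h2) (le_antisymm h3 h4)]

/-! ### Direct sums -/

theorem hasSummand_or_of_directSum {V W : PersistenceModule.{u, v} K} {p : Bar}
    (h : (V.directSum W).HasSummand p) : V.HasSummand p ∨ W.HasSummand p := by
  obtain ⟨x, φ, hx, hφ, hne⟩ := h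
  let iV : ∀ a, V.obj a →ₗ[K] (V.directSum W).obj a := fun a => LinearMap.inl K (V.obj a) (W.obj a)
  let iW : ∀ a, W.obj a →ₗ[K] (V.directSum W).obj a := fun a => LinearMap.inr K (V.obj a) (W.obj a)
  have hiV : ∀ {a b} (h : a ≤ b) y, iV b (V.map h y) = (V.directSum W).map h (iV a y) :=
    fun h y => Prod.ext rfl (map_zero (W.map h)).symm
  have hiW : ∀ {a b} (h : a ≤ b) y, iW b (W.map h y) = (V.directSum W).map h (iW a y) :=
    fun h y => Prod.ext (map_zero (V.map h)).symm rfl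
  have hsum : φ p.birth (iV _ x.1) + φ p.birth (iW _ x.2) ≠ 0 := by
    rw [← map_add]
    have : iV _ x.1 + iW _ x.2 = x := Prod.ext (add_zero x.1) (zero_add x.2)
    rwa [this]
  by_cases h0 : φ p.birth (iV _ x.1) = 0
  · right
    refine ⟨x.2, fun a => φ a ∘ₗ iW a, fun h hd => congrArg Prod.snd (hx h hd), ⟨?_, ?_⟩, ?_⟩
    · intro a b h y hl hd
      simpa [hiW] using hφ.map_eq h (iW _ y) hl hd
    · intro a b h y ha hl hd
      simpa [hiW] using hφ.map_eq_zero h (iW _ y) ha hl hd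
    · simpa [h0] using hsum
  · left
    refine ⟨x.1, fun a => φ a ∘ₗ iV a, fun h hd => congrArg Prod.fst (hx h hd), ⟨?_, ?_⟩, h0⟩
    · intro a b h y hl hd
      simpa [hiV] using hφ.map_eq h (iV _ y) hl hd
    · intro a b h y ha hl hd
      simpa [hiV] using hφ.map_eq_zero h (iV _ y) ha hl hd

/-- In a multiplicity-free module two non-zero pairings for the same interval both factor through
the same one-dimensional summand, so they are not orthogonal. -/
theorem HasDiagram.false_of_orthogonal_pairings {M : PersistenceModule.{u, v} K} {D : Diagram}
    (hD : M.HasDiagram D) (hnd : D.Nodup) {p : Bar} {x₁ x₂ : M.obj p.birth}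
    {φ₁ φ₂ : ∀ a, M.obj a →ₗ[K] K} (hx₁ : M.DiesAt x₁ p.death) (hx₂ : M.DiesAt x₂ p.death)
    (hφ₁ : M.IsCosection p.birth p.death φ₁) (hφ₂ : M.IsCosection p.birth p.death φ₂)
    (h₁ : φ₁ p.birth x₁ ≠ 0) (h₂ : φ₂ p.birth x₂ ≠ 0) (h₁₂ : φ₁ p.birth x₂ = 0) : False := by
  obtain ⟨n, q, rfl, ⟨f⟩⟩ := hD
  have hinj : Function.Injective q := fun i j hij =>
    Multiset.inj_on_of_nodup_map hnd i (Finset.mem_univ i) j (Finset.mem_univ j) hij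
  have bar_eq : ∀ {x : M.obj p.birth} {φ : ∀ a, M.obj a →ₗ[K] K}, M.DiesAt x p.death →
      M.IsCosection p.birth p.death φ → ∀ {j : Fin n},
      (φ p.birth ∘ₗ (f.symm.equiv _).toLinearMap) (finiteSumSingle _ _ j (f.equiv _ x j)) ≠ 0 →
      q j = p := by
    intro x φ hx hφ j hj
    obtain ⟨⟨k1, k2⟩, k3, k4⟩ := (hφ.comp_iso f.symm).bounds_of_apply_single_ne_zero le_rfl p.lt
      (hx.map_iso f) hj
    exact Bar.ext (le_antisymm k2 k1) (le_antisymm k4 k3)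
  have expand : ∀ (x : M.obj p.birth) (φ : ∀ a, M.obj a →ₗ[K] K), φ p.birth x =
      ∑ j, (φ p.birth ∘ₗ (f.symm.equiv _).toLinearMap)
        (finiteSumSingle _ _ j (f.equiv _ x j)) := by
    intro x φ
    rw [← map_sum, sum_finiteSumSingle]
    simp [Iso.symm]
  obtain ⟨j, -, hj⟩ := Finset.exists_ne_zero_of_sum_ne_zero (expand x₁ φ₁ ▸ h₁)
  obtain ⟨j', -, hj'⟩ := Finset.exists_ne_zero_of_sum_ne_zero (expand x₂ φ₂ ▸ h₂)
  have hqj := bar_eq hx₁ hφ₁ hj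
  obtain rfl : j' = j := hinj ((bar_eq hx₂ hφ₂ hj').trans hqj.symm)
  have hc : (q j').Contains p.birth := by
    rw [hqj]
    exact ⟨le_rfl, p.lt⟩
  have hy₂ : f.equiv _ x₂ j' ⟨hc⟩ ≠ 0 := by
    intro h
    apply hj'
    have : f.equiv _ x₂ j' = 0 := funext fun k => h
    rw [this, map_zero, map_zero]
  have hprop : f.equiv _ x₁ j' = (f.equiv _ x₁ j' ⟨hc⟩ / f.equiv _ x₂ j' ⟨hc⟩) •
      f.equiv _ x₂ j' :=
    funext fun k => (div_mul_cancel₀ _ hy₂).symm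
  rw [expand, Finset.sum_eq_single j'] at h₁₂
  · apply hj
    rw [hprop, map_smul, map_smul, h₁₂, smul_zero]
  · intro k _ hk
    by_contra h
    exact hk (hinj ((bar_eq hx₂ hφ₁ h).trans hqj.symm))
  · simp

theorem IsMultiplicityFree.not_hasSummand_both {M V W : PersistenceModule.{u, v} K}
    (hM : M.IsMultiplicityFree) (e : M.Iso (V.directSum W)) {p : Bar} (hV : V.HasSummand p)
    (hW : W.HasSummand p) : False := by
  obtain ⟨D, hnd, n, q, hq, ⟨f⟩⟩ := hM
  have hD : (V.directSum W).HasDiagram D :=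
    ⟨n, q, hq, ⟨{ equiv := fun a => (e.symm.equiv a).trans (f.equiv a)
                  comm := fun h x => by simp [e.symm.comm, f.comm] }⟩⟩
  obtain ⟨x, φ, hx, hφ, hne⟩ := hV
  obtain ⟨x', φ', hx', hφ', hne'⟩ := hW
  let π₁ : ∀ a, (V.directSum W).obj a →ₗ[K] V.obj a := fun a =>
    LinearMap.fst K (V.obj a) (W.obj a)
  let π₂ : ∀ a, (V.directSum W).obj a →ₗ[K] W.obj a := fun a =>
    LinearMap.snd K (V.obj a) (W.obj a)
  exact hD.false_of_orthogonal_pairings hnd (p := p)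
    (x₁ := ((x, 0) : V.obj _ × W.obj _)) (x₂ := ((0, x') : V.obj _ × W.obj _))
    (φ₁ := fun a => φ a ∘ₗ π₁ a) (φ₂ := fun a => φ' a ∘ₗ π₂ a)
    (fun h hd => Prod.ext (hx h hd) (map_zero (W.map h)))
    (fun h hd => Prod.ext (map_zero (V.map h)) (hx' h hd))
    ⟨fun h y hl hd => hφ.map_eq h y.1 hl hd, fun h y ha hl hd => hφ.map_eq_zero h y.1 ha hl hd⟩
    ⟨fun h y hl hd => hφ'.map_eq h y.2 hl hd, fun h y ha hl hd => hφ'.map_eq_zero h y.2 ha hl hd⟩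
    hne hne' (map_zero (φ p.birth))

end PersistenceModule

/-! ### Closeness of intervals -/

/-- The end points of the two intervals differ by at most `ε`; an infinite death is close only to
an infinite death. -/
structure Bar.Near (p q : Bar) (ε : ℝ) : Prop where
  birth_le : p.birth ≤ q.birth + ε
  le_birth : q.birth ≤ p.birth + ε
  death_le : p.death ≤ q.death + (ε : WithTop ℝ)
  le_death : q.death ≤ p.death + (ε : WithTop ℝ)

theorem Bar.Near.trans {p q r : Bar} {ε δ : ℝ} (h : p.Near q ε) (h' : q.Near r δ) :
    p.Near r (ε + δ) where
  birth_le := by linarith [h.birth_le, h'.birth_le]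
  le_birth := by linarith [h.le_birth, h'.le_birth]
  death_le := by
    refine h.death_le.trans ((add_le_add_left h'.death_le _).trans (le_of_eq ?_))
    rw [WithTop.coe_add, add_assoc, add_comm (δ : WithTop ℝ)]
  le_death := by
    refine h'.le_death.trans ((add_le_add_left h.le_death _).trans (le_of_eq ?_))
    rw [WithTop.coe_add, add_assoc]

theorem Bar.Near.mono {p q : Bar} {ε δ : ℝ} (h : p.Near q ε) (hεδ : ε ≤ δ) : p.Near q δ where
  birth_le := by linarith [h.birth_le]
  le_birth := by linarith [h.le_birth]
  death_le := h.death_le.trans (by gcongr; exact_mod_cast hεδ)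
  le_death := h.le_death.trans (by gcongr; exact_mod_cast hεδ)

theorem WithTop.le_of_forall_pos_le_add_coe {x y : WithTop ℝ}
    (h : ∀ ε : ℝ, 0 < ε → x ≤ y + (ε : WithTop ℝ)) : x ≤ y := by
  induction y with
  | top => exact le_top
  | coe y =>
    induction x with
    | top => simpa using h 1 one_pos
    | coe x =>
      exact WithTop.coe_le_coe.2 (le_of_forall_pos_le_add fun ε hε => by exact_mod_cast h ε hε)

theorem Bar.eq_of_forall_near {p q : Bar} (h : ∀ ε : ℝ, 0 < ε → p.Near q ε) : p = q :=
  Bar.ext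
    (le_antisymm (le_of_forall_pos_le_add fun ε hε => (h ε hε).birth_le)
      (le_of_forall_pos_le_add fun ε hε => (h ε hε).le_birth))
    (le_antisymm (WithTop.le_of_forall_pos_le_add_coe fun ε hε => (h ε hε).death_le)
      (WithTop.le_of_forall_pos_le_add_coe fun ε hε => (h ε hε).le_death))

theorem Bar.exists_pos_forall_not_near (D : Diagram) {p : Bar} (hp : p ∉ D) :
    ∃ ε : ℝ, 0 < ε ∧ ∀ q ∈ D, ¬ q.Near p ε := by
  induction D using Multiset.induction with
  | empty => exact ⟨1, one_pos, by simp⟩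
  | cons q D ih =>
    rw [Multiset.mem_cons, not_or] at hp
    obtain ⟨ε, hε, h⟩ := ih hp.2
    obtain ⟨δ, hδ, h'⟩ : ∃ δ : ℝ, 0 < δ ∧ ¬ q.Near p δ := by
      by_contra! hall
      exact hp.1 (Bar.eq_of_forall_near hall).symm
    refine ⟨min ε δ, lt_min hε hδ, fun r hr hn => ?_⟩
    rcases Multiset.mem_cons.1 hr with rfl | hr
    · exact h' (hn.mono (min_le_right _ _))
    · exact h r hr (hn.mono (min_le_left _ _))

theorem Bar.exists_pos_birth_add_lt_death (p : Bar) :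
    ∃ ε : ℝ, 0 < ε ∧ ((p.birth + ε : ℝ) : WithTop ℝ) < p.death := by
  obtain ⟨b, d, h⟩ := p
  induction d with
  | top => exact ⟨1, one_pos, WithTop.coe_lt_top _⟩
  | coe d =>
    have h := WithTop.coe_lt_coe.1 h
    exact ⟨(d - b) / 2, by linarith, WithTop.coe_lt_coe.2 (show b + (d - b) / 2 < d by linarith)⟩

theorem le_add_and_le_add_of_extDist_lt {x y : WithTop ℝ} {ε : ℝ}
    (h : extDist x y < ENNReal.ofReal ε) :
    x ≤ y + (ε : WithTop ℝ) ∧ y ≤ x + (ε : WithTop ℝ) := by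
  induction x with
  | top =>
    induction y with
    | top => simp
    | coe y => exact absurd h (by simp [extDist])
  | coe x =>
    induction y with
    | top => exact absurd h (by simp [extDist])
    | coe y =>
      have h : edist x y < ENNReal.ofReal ε := h
      rw [edist_dist, ENNReal.ofReal_lt_ofReal_iff', Real.dist_eq, abs_lt] at h
      constructor <;> norm_cast <;> linarith [h.1.1, h.1.2]

theorem Bar.near_of_dist_lt {p q : Bar} {ε : ℝ} (h : p.dist q < ENNReal.ofReal ε) :
    p.Near q ε := by
  obtain ⟨hb, hd⟩ := max_lt_iff.1 h
  rw [edist_dist, ENNReal.ofReal_lt_ofReal_iff', Real.dist_eq, abs_lt] at hb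
  obtain ⟨h1, h2⟩ := le_add_and_le_add_of_extDist_lt hd
  exact ⟨by linarith [hb.1.2], by linarith [hb.1.1], h1, h2⟩

theorem Bar.diagDist_pos (p : Bar) : 0 < p.diagDist := by
  refine ENNReal.div_pos (fun h0 => ?_) (by simp)
  obtain ⟨ε, hε, h⟩ := p.exists_pos_birth_add_lt_death
  have h' := (le_add_and_le_add_of_extDist_lt
    (h0.trans_lt (ENNReal.ofReal_pos.2 hε))).2
  exact absurd (h.trans_le h') (by simp)

/-- Points of a diagram that are farther from the diagonal than the bottleneck distance have to be
matched. -/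
theorem exists_mem_dist_lt_of_bottleneckDist_lt {D E : Diagram} {p : Bar} {ε : ℝ≥0∞} (hp : p ∈ E)
    (hε : ε ≤ p.diagDist) (h : bottleneckDist D E < ε) : ∃ q ∈ D, q.dist p < ε := by
  obtain ⟨P, hP⟩ := iInf_lt_iff.1 h
  obtain ⟨h1, h23⟩ := max_lt_iff.1 hP
  obtain ⟨-, h3⟩ := max_lt_iff.1 h23
  rw [← P.right_eq, Multiset.mem_add] at hp
  rcases hp with hp | hp
  · obtain ⟨⟨q, r⟩, hqr, rfl⟩ := Multiset.mem_map.1 hp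
    refine ⟨q, ?_, (Multiset.le_sup (Multiset.mem_map_of_mem _ hqr)).trans_lt h1⟩
    rw [← P.left_eq]
    exact Multiset.mem_add.2 (Or.inl (Multiset.mem_map_of_mem Prod.fst hqr))
  · have := (Multiset.le_sup (Multiset.mem_map_of_mem Bar.diagDist hp)).trans_lt h3
    exact absurd (this.trans_le hε) (lt_irrefl _)

/-! ### Stability -/

namespace PersistenceModule

variable {K : Type u} [Field K]

theorem coe_lt_add_coe_neg_iff {a δ : ℝ} {d : WithTop ℝ} :
    (a : WithTop ℝ) < d + ((-δ : ℝ) : WithTop ℝ) ↔ ((a + δ : ℝ) : WithTop ℝ) < d := by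
  induction d with
  | top => simp [WithTop.coe_lt_top]
  | coe d =>
    norm_cast
    constructor <;> intro h <;> linarith

/-- Only one of the two composites of a `δ`-interleaving is used. -/
theorem HasSummand.exists_near_of_interleaving {M : PersistenceModule.{u, v} K}
    {N : PersistenceModule.{u, w} K} {δ : ℝ} (hδ : 0 ≤ δ) {α : ShiftHom M N δ} {β : ShiftHom N M δ}
    (hαβ : ∀ (a : ℝ) (x : M.obj a), β.app (a + δ) (α.app a x) = M.map (by linarith) x)
    {q : Bar} (hq : M.HasSummand q) (hlen : ((q.birth + 2 * δ : ℝ) : WithTop ℝ) < q.death)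
    {D : Diagram} (hD : N.HasDiagram D) : ∃ r ∈ D, r.Near q δ := by
  obtain ⟨x, φ, hx, hφ, hne⟩ := hq
  have hψ : N.IsCosection (q.birth - δ) (q.death + ((-δ : ℝ) : WithTop ℝ))
      (fun a => φ (a + δ) ∘ₗ β.app a) := by
    refine ⟨fun h y hl hd => ?_, fun h y ha hl hd => ?_⟩
    · rw [coe_lt_add_coe_neg_iff] at hd
      simpa [β.comm] using hφ.map_eq (by linarith) (β.app _ y) (by linarith) hd
    · rw [coe_lt_add_coe_neg_iff] at hd
      simpa [β.comm] using
        hφ.map_eq_zero (by linarith) (β.app _ y) (by linarith) (by linarith) hd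
  have hlen' : ((q.birth + δ + δ : ℝ) : WithTop ℝ) < q.death := by
    rwa [add_assoc, ← two_mul]
  have hy : N.DiesAt (α.app q.birth x) (q.death + (δ : WithTop ℝ)) := by
    intro a h hd
    obtain ⟨e, he⟩ : ∃ e : ℝ, (e : WithTop ℝ) = q.death := by
      rw [← WithTop.ne_top_iff_exists]
      intro htop
      rw [htop, WithTop.top_add] at hd
      exact WithTop.coe_ne_top (top_le_iff.1 hd)
    have hed : e + δ ≤ a := by
      rw [← he] at hd
      exact_mod_cast hd
    have hbe : q.birth ≤ e := (WithTop.coe_lt_coe.1 (he ▸ q.lt)).le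
    -- The element already dies at height `e + δ`, as the image of `x` at height `e`.
    rw [← N.map_comp (show q.birth + δ ≤ e + δ by linarith) hed, ← α.comm hbe,
      hx hbe he.ge, map_zero, map_zero]
  obtain ⟨r, hr, ⟨h1, h2⟩, h3, h4⟩ := hD.exists_mem_of_pairing hψ
    (show q.birth - δ ≤ q.birth + δ by linarith) (coe_lt_add_coe_neg_iff.2 hlen') hy (by
      rw [LinearMap.comp_apply, hαβ, hφ.map_eq _ _ le_rfl hlen']
      exact hne)
  refine ⟨r, hr, h2, by linarith, h4, ?_⟩
  have := add_le_add_left h3 (δ : WithTop ℝ)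
  rwa [add_assoc, ← WithTop.coe_add, neg_add_cancel, WithTop.coe_zero, add_zero] at this

end PersistenceModule

/-! ### Vines -/

theorem IsVine.eq_of_mem {t₁ t₂ : ℝ} {γ : Set.Icc t₁ t₂ → Diagram} (hγ : IsVine γ)
    {t : Set.Icc t₁ t₂} {p q : Bar} (hp : p ∈ γ t) (hq : q ∈ γ t) : p = q := by
  have h1 := hγ.card_le_one t
  obtain ⟨r, hr⟩ := Multiset.card_eq_one.1
    (le_antisymm h1 (Multiset.card_pos_iff_exists_mem.2 ⟨p, hp⟩))
  rw [hr, Multiset.mem_singleton] at hp hq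
  exact hp.trans hq.symm

namespace VineyardModule

variable {K : Type u} [Field K] {t₁ t₂ : ℝ}

theorem exists_near_of_hasSummand (W : VineyardModule.{u, v} K t₁ t₂) {s t : Set.Icc t₁ t₂}
    {q : Bar} (hq : (W.obj s).HasSummand q)
    (hlen : ((q.birth + 2 * |(s : ℝ) - t| : ℝ) : WithTop ℝ) < q.death)
    {D : Diagram} (hD : (W.obj t).HasDiagram D) : ∃ r ∈ D, r.Near q |(s : ℝ) - t| := by
  rcases lt_trichotomy s t with h | rfl | h
  · have h' : (s : ℝ) < t := h
    rw [abs_sub_comm, abs_of_pos (sub_pos.2 h')] at hlen ⊢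
    exact hq.exists_near_of_interleaving (sub_pos.2 h').le (W.interleaving s t h).left hlen hD
  · exact ⟨q, hD.mem_iff.2 hq, by constructor <;> simp⟩
  · have h' : (t : ℝ) < s := h
    rw [abs_of_pos (sub_pos.2 h')] at hlen ⊢
    exact hq.exists_near_of_interleaving (sub_pos.2 h').le (W.interleaving t s h).right hlen hD

theorem exists_forall_not_hasSummand (W : VineyardModule.{u, v} K t₁ t₂) (hW : W.IsGeneric)
    {γ : Set.Icc t₁ t₂ → Diagram} (hγ : IsVine γ) {t : Set.Icc t₁ t₂} {p : Bar} (hp : p ∈ γ t)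
    (hpW : ¬ (W.obj t).HasSummand p) :
    ∃ δ : ℝ, 0 < δ ∧ ∀ s : Set.Icc t₁ t₂, |(s : ℝ) - t| < δ → ∀ q ∈ γ s,
      ¬ (W.obj s).HasSummand q := by
  obtain ⟨D, -, hD⟩ := hW t
  obtain ⟨ε₁, hε₁, hfar⟩ := Bar.exists_pos_forall_not_near D (fun h => hpW (hD.mem_iff.1 h))
  obtain ⟨ε₂, hε₂, hlen⟩ := p.exists_pos_birth_add_lt_death
  -- Two steps of size `ε` stay below `ε₁`; births, deaths and twice the interleaving parameter
  -- together cost `4 ε ≤ ε₂` of the length of `p`.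
  set ε := min (ε₁ / 2) (ε₂ / 4) with hε
  have hεpos : 0 < ε := lt_min (by linarith) (by linarith)
  have hε1 : ε + ε ≤ ε₁ := by linarith [min_le_left (ε₁ / 2) (ε₂ / 4)]
  have hε2 : 4 * ε ≤ ε₂ := by linarith [min_le_right (ε₁ / 2) (ε₂ / 4)]
  obtain ⟨δ, hδ, hcont⟩ := hγ.continuous t (min (ENNReal.ofReal ε) p.diagDist)
    (lt_min (ENNReal.ofReal_pos.2 hεpos) p.diagDist_pos)
  refine ⟨min δ ε, lt_min hδ hεpos, fun s hs q hq hqW => ?_⟩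
  have hsε : |(s : ℝ) - t| ≤ ε := hs.le.trans (min_le_right _ _)
  obtain ⟨q', hq', hdist⟩ := exists_mem_dist_lt_of_bottleneckDist_lt hp (min_le_right _ _)
    (hcont s (hs.trans_le (min_le_left _ _)))
  obtain rfl : q = q' := hγ.eq_of_mem hq hq'
  have hqp : q.Near p ε := Bar.near_of_dist_lt (hdist.trans_le (min_le_left _ _))
  have hqlen : ((q.birth + 2 * |(s : ℝ) - t| : ℝ) : WithTop ℝ) < q.death := by
    have h1 : (((q.birth + 2 * |(s : ℝ) - t|) + ε : ℝ) : WithTop ℝ) < q.death + (ε : WithTop ℝ) :=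
      lt_of_le_of_lt (WithTop.coe_le_coe.2 (by linarith [hqp.birth_le]))
        (hlen.trans_le hqp.le_death)
    rw [WithTop.coe_add] at h1
    exact lt_of_add_lt_add_right h1
  obtain ⟨r, hr, hrq⟩ := W.exists_near_of_hasSummand hqW hqlen hD
  exact hfar r hr (((hrq.mono hsε).trans hqp).mono hε1)

end VineyardModule

theorem mainTheorem4 {K : Type u} [Field K] {t₁ t₂ : ℝ}
    (X V W : VineyardModule.{u, v} K t₁ t₂)
    (hX : X.IsGeneric) (hV : V.IsGeneric) (hW : W.IsGeneric)
    (hsum : Nonempty (X.Iso (V.directSum W)))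
    (γ : Set.Icc t₁ t₂ → Diagram) (hγ : X.IsVineOf γ) :
    (∀ t ∈ diagramSupport γ, ∀ p ∈ γ t, (V.obj t).HasBar p) ∨
      (∀ t ∈ diagramSupport γ, ∀ p ∈ γ t, (W.obj t).HasBar p) := by
  obtain ⟨e⟩ := hsum
  obtain ⟨n, g, hg, hgX, i, rfl⟩ := hγ
  have hvine := hg i
  have hor : ∀ t, ∀ p ∈ g i t, (V.obj t).HasSummand p ∨ (W.obj t).HasSummand p := by
    intro t p hp
    have hpX : p ∈ ∑ i, g i t := Multiset.mem_sum.2 ⟨i, Finset.mem_univ i, hp⟩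
    exact PersistenceModule.hasSummand_or_of_directSum
      (((hgX t).mem_iff.1 hpX).of_iso (e.iso t))
  have hnot : ∀ t p, (V.obj t).HasSummand p → (W.obj t).HasSummand p → False :=
    fun t p => (hX t).not_hasSummand_both (e.iso t)
  -- Passing to `ℝ`, the support becomes an order connected, hence connected, set of reals.
  set S : Set ℝ := Subtype.val '' diagramSupport (g i) with hS
  have hSconn : S.OrdConnected := by
    refine ⟨?_⟩
    rintro _ ⟨a, ha, rfl⟩ _ ⟨b, hb, rfl⟩ c hc
    exact ⟨⟨c, a.2.1.trans hc.1, hc.2.trans b.2.2⟩, hvine.support_interval.out ha hb hc, rfl⟩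
  have : PreconnectedSpace S := Subtype.preconnectedSpace hSconn.isPreconnected
  have hSmem : ∀ t : S, (t : ℝ) ∈ Set.Icc t₁ t₂ := by
    rintro ⟨_, a, -, rfl⟩
    exact a.2
  have hSbar : ∀ t : S, ∃ p, p ∈ g i ⟨t, hSmem t⟩ := by
    rintro ⟨_, a, ha, rfl⟩
    exact ha
  choose p hp using hSbar
  let f : S → Prop := fun t => (V.obj ⟨t, hSmem t⟩).HasSummand (p t)
  have hf : IsLocallyConstant f := by
    rw [IsLocallyConstant.iff_eventually_eq]
    intro t
    by_cases ht : f t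
    · obtain ⟨δ, hδ, h⟩ := W.exists_forall_not_hasSummand hW hvine (hp t) (hnot _ _ ht)
      filter_upwards [Metric.ball_mem_nhds t hδ] with s hs
      have hsW := h ⟨s, hSmem s⟩ hs (p s) (hp s)
      exact propext ⟨fun _ => ht, fun _ => (hor _ _ (hp s)).resolve_right hsW⟩
    · obtain ⟨δ, hδ, h⟩ := V.exists_forall_not_hasSummand hV hvine (hp t) ht
      filter_upwards [Metric.ball_mem_nhds t hδ] with s hs
      exact propext ⟨fun hs' => absurd hs' (h ⟨s, hSmem s⟩ hs (p s) (hp s)),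
        fun ht' => absurd ht' ht⟩
  obtain ⟨a, ha⟩ := hvine.support_nonempty
  have hconst : ∀ t : S, f t = f ⟨a, a, ha, rfl⟩ := fun t =>
    hf.apply_eq_of_preconnectedSpace t _
  have huniq : ∀ (t) (ht : t ∈ diagramSupport (g i)), ∀ q ∈ g i t, q = p ⟨t, t, ht, rfl⟩ :=
    fun t ht q hq => hvine.eq_of_mem hq (hp ⟨t, t, ht, rfl⟩)
  by_cases hfa : f ⟨a, a, ha, rfl⟩
  · left
    intro t ht q hq
    obtain ⟨D, -, hD⟩ := hV t
    refine ⟨D, hD, hD.mem_iff.2 ?_⟩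
    rw [huniq t ht q hq]
    exact (hconst ⟨t, t, ht, rfl⟩).mpr hfa
  · right
    intro t ht q hq
    obtain ⟨D, -, hD⟩ := hW t
    refine ⟨D, hD, hD.mem_iff.2 ((hor t q hq).resolve_left fun h => hfa ?_)⟩
    rw [huniq t ht q hq] at h
    exact (hconst ⟨t, t, ht, rfl⟩).mp h
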